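/- An \emph{mm-space} is a Polish metric space $X$ of diameter at most one with a Borel probability measure $\mu_X$ of full support. For functions $f,g:[0,1]^2\to\mathbb{R}$ let $\square_1(f,g)$ be the infimum of the $\varepsilon\ge 0$ for which there is a measurable set $S\subseteq[0,1]$ of Lebesgue measure at most $\varepsilon$ with $|f(s,t)-g(s,t)|\le\varepsilon$ for all $s,t\in[0,1]\setminus S$. For mm-spaces $X,Y$ let $$\underline{\square}_1(X,Y)=\inf_{\Psi_1,\Psi_2}\square_1\bigl(d_X\circ(\Psi_1\times\Psi_1),\,d_Y\circ(\Psi_2\times\Psi_2)\bigr),$$ the infimum over all measure preserving maps $\Psi_1:([0,1],\lambda)\to(X,\mu_X)$ and $\Psi_2:([0,1],\lambda)\to(Y,\mu_Y)$. Let $\omega$ be a nonprincipal ultrafilter on $\mathbb{N}$ and $(X_n)$ a sequence of mm-spaces. Let $\mathbf{X}$ be the set of sequences in $\prod_n X_n$, two sequences being identified if they agree for $\omega$-almost every $n$, with the pseudo-metric $d([x],[y])=\lim_\omega d_{X_n}(x_n,y_n)$; the \emph{metric ultralimit} $\underline{\mathbf{X}}$ is its quotient by the relation $d=0$, with projection $\pi:\mathbf{X}\to\underline{\mathbf{X}}$.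 For Borel sets $A_n\subseteq X_n$ put $[A_n]=\{[x]: x_n\in A_n\text{ for }\omega\text{-almost every }n\}$, of mass $\lim_\omega\mu_{X_n}(A_n)$. A set $N\subseteq\mathbf{X}$ is null if for every $\varepsilon>0$ it is contained in some $[A_n]$ of mass less than $\varepsilon$. A set $M\subseteq\mathbf{X}$ is measurable if $M\triangle[A_n]$ is null for some Borel $A_n$, and then $\mu_{\mathbf{X}}(M)=\lim_\omega\mu_{X_n}(A_n)$. A set $A\subseteq\underline{\mathbf{X}}$ is admissible if $\pi^{-1}(A)$ is measurable, and then $\mu_{\underline{\mathbf{X}}}(A)=\mu_{\mathbf{X}}(\pi^{-1}(A))$. The support of $\underline{\mathbf{X}}$ is the set of points $p$ such that every closed ball of positive radius around $p$ (such balls are admissible) has positive measure. The support is said to be isometric to an mm-space $X$ (as a metric measure space) if there is a surjective isometry $\Phi$ from $X$ onto the support such that, for every Borel set $B\subseteq X$, the set $\Phi(B)$ is admissible and $\mu_{\underline{\mathbf{X}}}(\Phi(B))=\mu_X(B)$. \textbf{Proposition.} Let $X$ be an mm-space. (1) If $\underline{\square}_1(X_n,X)\to 0$ as $n\to\infty$,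 then the support of the metric ultralimit $\underline{\mathbf{X}}$ is isometric to $X$. (2) Conversely, if the support of $\underline{\mathbf{X}}$ is isometric to $X$, then $X=\lim_\omega X_n$ in the $\underline{\square}_1$-metric, that is, for every $\varepsilon>0$, $$\{n : \underline{\square}_1(X_n,X)<\varepsilon\}\in\omega.$$ -/

import Mathlib

open MeasureTheory Filter Topology
open scoped ENNReal NNReal unitInterval

universe u v

/-- An mm-space: a Polish metric space of diameter at most one with a Borel probability measure of
full support. -/
structure MMSpace where
  carrier : Type u
  [metric : MetricSpace carrier]
  [complete : CompleteSpace carrier]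
  [separable : TopologicalSpace.SeparableSpace carrier]
  [meas : MeasurableSpace carrier]
  [borel : BorelSpace carrier]
  μ : Measure carrier
  [prob : IsProbabilityMeasure μ]
  [fullSupport : μ.IsOpenPosMeasure]
  dist_le_one : ∀ x y : carrier, dist x y ≤ 1

namespace MMSpace

instance : CoeSort MMSpace.{u} (Type u) := ⟨MMSpace.carrier⟩

attribute [instance] metric complete separable meas borel prob fullSupport

instance (X : MMSpace.{u}) : Nonempty X := nonempty_of_isProbabilityMeasure X.μ

/-! ### The box distance -/

/-- `f` and `g` are `ε`-close on `Sᶜ × Sᶜ` for some set `S ⊆ [0,1]` of Lebesgue measure at most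
`ε`. -/
def BoxClose (ε : ℝ≥0) (f g : I → I → ℝ) : Prop :=
  ∃ S : Set I, MeasurableSet S ∧ volume S ≤ ε ∧
    ∀ s ∉ S, ∀ t ∉ S, |f s t - g s t| ≤ ε

/-- The `□₁`-distance of two functions on `[0,1]²`: the infimal `ε` for which they are `ε`-close
outside a set of measure at most `ε`. -/
noncomputable def boxFun (f g : I → I → ℝ) : ℝ≥0∞ :=
  ⨅ (ε : ℝ≥0) (_ : BoxClose ε f g), (ε : ℝ≥0∞)

/-- The pull-back of the distance function of `X` under `Ψ : [0,1] → X`. -/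
def pullDist (X : MMSpace.{u}) (Ψ : I → X) : I → I → ℝ := fun s t => dist (Ψ s) (Ψ t)

/-- The `□₁`-distance of two mm-spaces: the infimum of the `□₁`-distances of the pulled back
distance functions over all pairs of measure preserving maps from `([0,1], λ)`. -/
noncomputable def boxDist (X : MMSpace.{u}) (Y : MMSpace.{v}) : ℝ≥0∞ :=
  ⨅ (Ψ₁ : I → X) (_ : MeasurePreserving Ψ₁ volume X.μ)
    (Ψ₂ : I → Y) (_ : MeasurePreserving Ψ₂ volume Y.μ),
    boxFun (X.pullDist Ψ₁) (Y.pullDist Ψ₂)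

/-! ### The set-theoretical ultralimit and its pseudo-metric -/

variable (ω : Ultrafilter ℕ) (X : ℕ → MMSpace.{u})

/-- The set-theoretical ultralimit: sequences `x ∈ ∏ X n`, identified when they agree for
`ω`-almost every `n`. -/
def SetUltralimit : Type u := (ω : Filter ℕ).Product (fun n => (X n : Type u))

variable {X}

/-- The class of a sequence of points. -/
def cls (x : ∀ n, X n) : SetUltralimit ω X :=
  @Quotient.mk' _ (productSetoid (ω : Filter ℕ) (fun n => (X n : Type u))) x

variable {ω}

theorem cls_surjective (p : SetUltralimit ω X) : ∃ x, cls ω x = p := Quotient.exists_rep p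

theorem cls_eq_cls {x y : ∀ n, X n} : cls ω x = cls ω y ↔ ∀ᶠ n in (ω : Filter ℕ), x n = y n :=
  @Quotient.eq _ (productSetoid (ω : Filter ℕ) (fun n => (X n : Type u))) x y

theorem tendsto_dist (x y : ∀ n, X n) :
    Tendsto (fun n => dist (x n) (y n)) (ω : Filter ℕ)
      (𝓝 (limUnder (ω : Filter ℕ) fun n => dist (x n) (y n))) := by
  apply tendsto_nhds_limUnder
  obtain ⟨d, -, hd⟩ := (isCompact_Icc (a := (0 : ℝ)) (b := 1)).ultrafilter_le_nhds
    (ω.map fun n => dist (x n) (y n)) (by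
      rw [le_principal_iff, Ultrafilter.mem_coe, Ultrafilter.mem_map]
      exact Filter.univ_mem' fun n => ⟨dist_nonneg, (X n).dist_le_one _ _⟩)
  exact ⟨d, hd⟩

/-- `d([x], [y]) = lim_ω d(x n, y n)`. -/
noncomputable instance : Dist (SetUltralimit ω X) where
  dist := Quotient.lift₂ (s₁ := productSetoid (ω : Filter ℕ) (fun n => (X n : Type u)))
    (s₂ := productSetoid (ω : Filter ℕ) (fun n => (X n : Type u)))
    (fun x y => limUnder (ω : Filter ℕ) fun n => dist (x n) (y n)) (by
      intro a b a' b' h h'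
      refine (Tendsto.limUnder_eq ?_)
      refine (tendsto_dist a' b').congr' ?_
      filter_upwards [h, h'] with n hn hn'
      rw [hn, hn'])

theorem dist_cls (x y : ∀ n, X n) :
    dist (cls ω x) (cls ω y) = limUnder (ω : Filter ℕ) fun n => dist (x n) (y n) := rfl

theorem tendsto_dist_cls (x y : ∀ n, X n) :
    Tendsto (fun n => dist (x n) (y n)) (ω : Filter ℕ) (𝓝 (dist (cls ω x) (cls ω y))) :=
  tendsto_dist x y

noncomputable instance : PseudoMetricSpace (SetUltralimit ω X) where
  dist_self p := by
    obtain ⟨x, rfl⟩ := cls_surjective p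
    refine tendsto_nhds_unique (tendsto_dist_cls x x) ?_
    simp
  dist_comm p q := by
    obtain ⟨x, rfl⟩ := cls_surjective p
    obtain ⟨y, rfl⟩ := cls_surjective q
    rw [dist_cls, dist_cls]
    simp only [dist_comm]
  dist_triangle p q r := by
    obtain ⟨x, rfl⟩ := cls_surjective p
    obtain ⟨y, rfl⟩ := cls_surjective q
    obtain ⟨z, rfl⟩ := cls_surjective r
    exact le_of_tendsto_of_tendsto' (tendsto_dist_cls x z)
      ((tendsto_dist_cls x y).add (tendsto_dist_cls y z)) fun n => dist_triangle _ _ _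

/-! ### The ultralimit measure on the set-theoretical ultralimit -/

/-- The ultralimit of a sequence of subsets. -/
def limSet (ω : Ultrafilter ℕ) (A : ∀ n, Set (X n)) : Set (SetUltralimit ω X) :=
  {p | ∃ x, cls ω x = p ∧ ∀ᶠ n in (ω : Filter ℕ), x n ∈ A n}

/-- The finitely additive measure of an ultralimit set: the ultralimit of the measures. -/
noncomputable def limMass (ω : Ultrafilter ℕ) (A : ∀ n, Set (X n)) : ℝ≥0∞ :=
  limUnder (ω : Filter ℕ) fun n => (X n).μ (A n)

/-- Nullsets: for every `ε > 0`, contained in an ultralimit of measurable sets of mass less than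
`ε`. -/
def IsNull (N : Set (SetUltralimit ω X)) : Prop :=
  ∀ ε : ℝ≥0∞, 0 < ε → ∃ A : ∀ n, Set (X n), (∀ n, MeasurableSet (A n)) ∧
    N ⊆ limSet ω A ∧ limMass ω A < ε

/-- `M` differs from the ultralimit of the measurable sets `A n` by a nullset. -/
def Approx (M : Set (SetUltralimit ω X)) (A : ∀ n, Set (X n)) : Prop :=
  (∀ n, MeasurableSet (A n)) ∧ IsNull (symmDiff (limSet ω A) M)

theorem cls_mem_limSet {x : ∀ n, X n} {A : ∀ n, Set (X n)} :
    cls ω x ∈ limSet ω A ↔ ∀ᶠ n in (ω : Filter ℕ), x n ∈ A n := by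
  constructor
  · rintro ⟨y, hy, h⟩
    filter_upwards [cls_eq_cls.1 hy, h] with n h1 h2
    rwa [← h1]
  · exact fun h => ⟨x, rfl, h⟩

theorem tendsto_limMass (A : ∀ n, Set (X n)) :
    Tendsto (fun n => (X n).μ (A n)) (ω : Filter ℕ) (𝓝 (limMass ω A)) := by
  apply tendsto_nhds_limUnder
  obtain ⟨d, -, hd⟩ := (isCompact_univ (X := ℝ≥0∞)).ultrafilter_le_nhds
    (ω.map fun n => (X n).μ (A n)) (by simp)
  exact ⟨d, hd⟩

theorem limMass_le_one (A : ∀ n, Set (X n)) : limMass ω A ≤ 1 :=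
  le_of_tendsto' (tendsto_limMass A) fun _ => prob_le_one

theorem limSet_compl (A : ∀ n, Set (X n)) : limSet ω (fun n => (A n)ᶜ) = (limSet ω A)ᶜ := by
  ext p
  obtain ⟨x, rfl⟩ := cls_surjective p
  rw [Set.mem_compl_iff, cls_mem_limSet, cls_mem_limSet, ← Ultrafilter.eventually_not]
  rfl

theorem limSet_union (A B : ∀ n, Set (X n)) :
    limSet ω (fun n => A n ∪ B n) = limSet ω A ∪ limSet ω B := by
  ext p
  obtain ⟨x, rfl⟩ := cls_surjective p
  rw [Set.mem_union, cls_mem_limSet, cls_mem_limSet, cls_mem_limSet, ← Ultrafilter.eventually_or]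
  rfl

theorem limSet_inter (A B : ∀ n, Set (X n)) :
    limSet ω (fun n => A n ∩ B n) = limSet ω A ∩ limSet ω B := by
  ext p
  obtain ⟨x, rfl⟩ := cls_surjective p
  rw [Set.mem_inter_iff, cls_mem_limSet, cls_mem_limSet, cls_mem_limSet, ← eventually_and]
  rfl

theorem limSet_diff (A B : ∀ n, Set (X n)) :
    limSet ω (fun n => A n \ B n) = limSet ω A \ limSet ω B := by
  simp only [Set.sdiff_eq, limSet_inter, limSet_compl]

theorem limSet_empty : limSet ω (fun n => (∅ : Set (X n))) = ∅ := by
  ext p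
  obtain ⟨x, rfl⟩ := cls_surjective p
  simp [cls_mem_limSet, ω.neBot.ne]

theorem limMass_empty : limMass ω (fun n => (∅ : Set (X n))) = 0 :=
  tendsto_nhds_unique (tendsto_limMass _) (by simp)

theorem eventually_subset {A B : ∀ n, Set (X n)} (h : limSet ω A ⊆ limSet ω B) :
    ∀ᶠ n in (ω : Filter ℕ), A n ⊆ B n := by
  classical
  by_contra hc
  rw [← Ultrafilter.eventually_not] at hc
  have : ∀ n, ∃ x : X n, ¬ A n ⊆ B n → x ∈ A n ∧ x ∉ B n := by
    intro n
    by_cases hn : A n ⊆ B n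
    · exact ⟨Classical.arbitrary _, fun h => (h hn).elim⟩
    · obtain ⟨x, h1, h2⟩ := Set.not_subset.1 hn
      exact ⟨x, fun _ => ⟨h1, h2⟩⟩
  choose x hx using this
  have h1 : cls ω x ∈ limSet ω B := h (cls_mem_limSet.2 (hc.mono fun n hn => (hx n hn).1))
  obtain ⟨n, hn, hn'⟩ := ((cls_mem_limSet.1 h1).and hc).exists
  exact (hx n hn').2 hn

theorem limMass_mono {A B : ∀ n, Set (X n)} (h : limSet ω A ⊆ limSet ω B) :
    limMass ω A ≤ limMass ω B :=
  le_of_tendsto_of_tendsto (tendsto_limMass A) (tendsto_limMass B)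
    ((eventually_subset h).mono fun _ hn => measure_mono hn)

theorem limMass_union_le (A B : ∀ n, Set (X n)) :
    limMass ω (fun n => A n ∪ B n) ≤ limMass ω A + limMass ω B :=
  le_of_tendsto_of_tendsto' (tendsto_limMass _) ((tendsto_limMass A).add (tendsto_limMass B))
    fun _ => measure_union_le _ _

theorem limMass_union_add_inter (A : ∀ n, Set (X n)) {B : ∀ n, Set (X n)}
    (hB : ∀ n, MeasurableSet (B n)) :
    limMass ω (fun n => A n ∪ B n) + limMass ω (fun n => A n ∩ B n) =
      limMass ω A + limMass ω B := by
  refine tendsto_nhds_unique ((tendsto_limMass _).add (tendsto_limMass _)) ?_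
  simp only [measure_union_add_inter _ (hB _)]
  exact (tendsto_limMass A).add (tendsto_limMass B)

/-- Saturation: countably many ultralimit sets are covered by one of no larger mass than
the supremum of the masses of the finite unions. -/
theorem exists_cover (A : ℕ → ∀ n, Set (X n)) (hA : ∀ k n, MeasurableSet (A k n)) (c : ℝ≥0∞)
    (hc : c ≠ ∞) (h : ∀ k, limMass ω (fun n => Set.accumulate (fun j => A j n) k) ≤ c) :
    ∃ B : ∀ n, Set (X n), (∀ n, MeasurableSet (B n)) ∧ (∀ k, limSet ω (A k) ⊆ limSet ω B) ∧
      limMass ω B ≤ c := by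
  classical
  let acc : ℕ → ∀ n, Set (X n) := fun k n => Set.accumulate (fun j => A j n) k
  have hacc : ∀ k n, MeasurableSet (acc k n) := fun k n =>
    MeasurableSet.biUnion (Set.to_countable _) fun j _ => hA j n
  let E : ℕ → ∀ n, Set (X n) := fun k n =>
    if (X n).μ (acc k n) ≤ c + (k + 1 : ℝ≥0∞)⁻¹ then acc k n else ∅
  have hEmeas : ∀ k n, MeasurableSet (E k n) := by
    intro k n
    dsimp only [E]
    split_ifs
    exacts [hacc k n, MeasurableSet.empty]
  have hmono : ∀ n, Monotone fun k => acc k n := fun n => Set.monotone_accumulate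
  have hdir : ∀ n, Directed (· ⊆ ·) fun k => E k n := by
    intro n i j
    by_cases hi : (X n).μ (acc i n) ≤ c + (i + 1 : ℝ≥0∞)⁻¹
    · by_cases hj : (X n).μ (acc j n) ≤ c + (j + 1 : ℝ≥0∞)⁻¹
      · rcases le_total i j with hij | hij
        · exact ⟨j, by simpa [E, hi, hj] using hmono n hij, subset_rfl⟩
        · exact ⟨i, subset_rfl, by simpa [E, hi, hj] using hmono n hij⟩
      · exact ⟨i, subset_rfl, by simp [E, hj]⟩
    · exact ⟨j, by simp [E, hi], subset_rfl⟩
  have hgood : ∀ k : ℕ, ∀ᶠ n in (ω : Filter ℕ), (X n).μ (acc k n) ≤ c + (k + 1 : ℝ≥0∞)⁻¹ := by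
    intro k
    have hlt : limMass ω (acc k) < c + (k + 1 : ℝ≥0∞)⁻¹ :=
      (h k).trans_lt (ENNReal.lt_add_right hc (by simp))
    exact ((tendsto_limMass (acc k)).eventually (gt_mem_nhds hlt)).mono fun _ hn => hn.le
  refine ⟨fun n => ⋃ k, E k n, fun n => MeasurableSet.iUnion fun k => hEmeas k n, ?_, ?_⟩
  · intro k p hp
    obtain ⟨x, rfl⟩ := cls_surjective p
    rw [cls_mem_limSet] at hp ⊢
    filter_upwards [hp, hgood k] with n h1 h2
    refine Set.mem_iUnion.2 ⟨k, ?_⟩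
    simp only [E, h2, if_true]
    exact Set.subset_accumulate h1
  · have key : ∀ K : ℕ, limMass ω (fun n => ⋃ k, E k n) ≤ c + (K + 1 : ℝ≥0∞)⁻¹ := by
      intro K
      refine le_of_tendsto (tendsto_limMass _) ((hgood K).mono fun n hn => ?_)
      rw [(hdir n).measure_iUnion]
      refine iSup_le fun k => ?_
      by_cases hk : (X n).μ (acc k n) ≤ c + (k + 1 : ℝ≥0∞)⁻¹
      · simp only [E, hk, if_true]
        rcases le_total k K with hkK | hkK
        · exact (measure_mono (hmono n hkK)).trans hn
        · refine hk.trans ?_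
          gcongr
      · simp [E, hk]
    refine ge_of_tendsto' (x := atTop) (f := fun K : ℕ => c + (K + 1 : ℝ≥0∞)⁻¹) ?_ key
    have h0 : Tendsto (fun K : ℕ => ((K + 1 : ℕ) : ℝ≥0∞)⁻¹) atTop (𝓝 0) :=
      ENNReal.tendsto_inv_nat_nhds_zero.comp (tendsto_add_atTop_nat 1)
    simpa using (tendsto_const_nhds (x := c)).add h0

theorem IsNull.mono {M N : Set (SetUltralimit ω X)} (h : IsNull N) (hMN : M ⊆ N) : IsNull M :=
  fun ε hε => let ⟨A, h1, h2, h3⟩ := h ε hε; ⟨A, h1, hMN.trans h2, h3⟩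

theorem limMass_accumulate_le (A : ℕ → ∀ n, Set (X n)) (k : ℕ) :
    limMass ω (fun n => Set.accumulate (fun j => A j n) k) ≤
      ∑ j ∈ Finset.range (k + 1), limMass ω (A j) := by
  refine le_of_tendsto_of_tendsto' (tendsto_limMass _)
    (tendsto_finsetSum _ fun j _ => tendsto_limMass (A j)) fun n => ?_
  have : Set.accumulate (fun j => A j n) k = ⋃ j ∈ Finset.range (k + 1), A j n := by
    ext x
    simp [Set.mem_accumulate]
  rw [this]
  exact measure_biUnion_finset_le _ _

theorem IsNull.iUnion {N : ℕ → Set (SetUltralimit ω X)} (h : ∀ k, IsNull (N k)) :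
    IsNull (⋃ k, N k) := by
  intro ε hε
  obtain ⟨c, hc0, hcε⟩ := exists_between hε
  obtain ⟨δ, hδ, hδc⟩ := ENNReal.exists_pos_sum_of_countable' hc0.ne' ℕ
  choose A hA hN hm using fun k => h k (δ k) (hδ k)
  obtain ⟨B, hB, hcov, hBc⟩ := exists_cover A hA c hcε.ne_top fun k =>
    (limMass_accumulate_le A k).trans
      (((Finset.sum_le_sum fun j _ => (hm j).le).trans (ENNReal.sum_le_tsum _)).trans hδc.le)
  exact ⟨B, hB, Set.iUnion_subset fun k => (hN k).trans (hcov k), hBc.trans_lt hcε⟩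

theorem isNull_empty : IsNull (∅ : Set (SetUltralimit ω X)) := fun _ hε =>
  ⟨fun _ => ∅, fun _ => MeasurableSet.empty, Set.empty_subset _, by rwa [limMass_empty]⟩

theorem IsNull.union {M N : Set (SetUltralimit ω X)} (hM : IsNull M) (hN : IsNull N) :
    IsNull (M ∪ N) := by
  have : IsNull (⋃ k : ℕ, if k = 0 then M else N) :=
    IsNull.iUnion fun k => by split_ifs <;> assumption
  refine this.mono (Set.union_subset ?_ ?_)
  · exact Set.subset_iUnion_of_subset 0 (by simp)
  · exact Set.subset_iUnion_of_subset 1 (by simp)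

theorem limMass_eq_zero {A : ∀ n, Set (X n)} (h : IsNull (limSet ω A)) : limMass ω A = 0 := by
  refine le_antisymm (le_of_forall_gt fun ε hε => ?_) zero_le
  obtain ⟨B, -, hB, hBε⟩ := h ε hε
  exact (limMass_mono hB).trans_lt hBε

theorem limMass_le_of_isNull_diff {A B : ∀ n, Set (X n)} (h : IsNull (limSet ω A \ limSet ω B)) :
    limMass ω A ≤ limMass ω B := by
  rw [← limSet_diff] at h
  calc limMass ω A ≤ limMass ω (fun n => B n ∪ (A n \ B n)) := limMass_mono (by
        rw [limSet_union, limSet_diff]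
        intro p hp
        by_cases hB : p ∈ limSet ω B
        · exact Or.inl hB
        · exact Or.inr ⟨hp, hB⟩)
    _ ≤ limMass ω B + limMass ω (fun n => A n \ B n) := limMass_union_le _ _
    _ = limMass ω B := by rw [limMass_eq_zero h, add_zero]

/-- The measure of a measurable set does not depend on the approximating ultralimit set. -/
theorem Approx.limMass_eq {M : Set (SetUltralimit ω X)} {A B : ∀ n, Set (X n)}
    (hA : Approx M A) (hB : Approx M B) : limMass ω A = limMass ω B := by
  have h := hA.2.union hB.2
  refine le_antisymm (limMass_le_of_isNull_diff (h.mono ?_))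
    (limMass_le_of_isNull_diff (h.mono ?_)) <;>
  · intro p hp
    simp only [Set.mem_union, Set.mem_symmDiff, Set.mem_sdiff] at hp ⊢
    tauto

theorem Approx.limSet {A : ∀ n, Set (X n)} (hA : ∀ n, MeasurableSet (A n)) :
    Approx (limSet ω A) A := ⟨hA, by simpa using isNull_empty⟩

theorem Approx.compl {M : Set (SetUltralimit ω X)} {A : ∀ n, Set (X n)} (h : Approx M A) :
    Approx Mᶜ (fun n => (A n)ᶜ) := by
  refine ⟨fun n => (h.1 n).compl, h.2.mono ?_⟩
  rw [limSet_compl]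
  intro p hp
  simp only [Set.mem_symmDiff, Set.mem_compl_iff] at hp ⊢
  tauto

/-- A countable union of sets approximated by `A k` is approximated by a single `B`, whose mass is
the supremum of the masses of the finite unions. -/
theorem Approx.iUnion {M : ℕ → Set (SetUltralimit ω X)} {A : ℕ → ∀ n, Set (X n)}
    (h : ∀ k, Approx (M k) (A k)) :
    ∃ B, Approx (⋃ k, M k) B ∧
      limMass ω B = ⨆ k, limMass ω (fun n => Set.accumulate (fun j => A j n) k) := by
  set c : ℝ≥0∞ := ⨆ k, limMass ω (fun n => Set.accumulate (fun j => A j n) k) with hc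
  have hc1 : c ≤ 1 := iSup_le fun k => limMass_le_one _
  have hctop : c ≠ ∞ := (hc1.trans_lt ENNReal.one_lt_top).ne
  obtain ⟨B, hB, hcov, hBc⟩ := exists_cover A (fun k => (h k).1) c hctop (fun k => le_iSup
    (fun k => limMass ω (fun n => Set.accumulate (fun j => A j n) k)) k)
  have haccmeas : ∀ k n, MeasurableSet (Set.accumulate (fun j => A j n) k) := fun k n =>
    MeasurableSet.biUnion (Set.to_countable _) fun j _ => (h j).1 n
  have haccsub : ∀ k, MMSpace.limSet ω (fun n => Set.accumulate (fun j => A j n) k) ⊆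
      ⋃ j, MMSpace.limSet ω (A j) := by
    intro k
    induction k with
    | zero =>
      refine Set.subset_iUnion_of_subset 0 ?_
      simp
    | succ k ih =>
      simp only [Set.accumulate_succ]
      rw [limSet_union]
      exact Set.union_subset ih (Set.subset_iUnion (fun j => MMSpace.limSet ω (A j)) (k + 1))
  have haccB : ∀ k, MMSpace.limSet ω (fun n => Set.accumulate (fun j => A j n) k) ⊆
      MMSpace.limSet ω B := fun k => (haccsub k).trans (Set.iUnion_subset hcov)
  have hBeq : limMass ω B = c := le_antisymm hBc (iSup_le fun k => limMass_mono (haccB k))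
  have hdiff : IsNull (MMSpace.limSet ω B \ ⋃ j, MMSpace.limSet ω (A j)) := by
    intro ε hε
    obtain ⟨k, hk⟩ : ∃ k, c < limMass ω (fun n => Set.accumulate (fun j => A j n) k) + ε := by
      by_contra hcon
      push Not at hcon
      have h1 : c + ε ≤ c := by
        conv_lhs => rw [hc]
        rw [ENNReal.iSup_add]
        exact iSup_le hcon
      exact absurd h1 (not_le.2 (ENNReal.lt_add_right hctop hε.ne'))
    refine ⟨fun n => B n \ Set.accumulate (fun j => A j n) k,
      fun n => (hB n).diff (haccmeas k n), ?_, ?_⟩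
    · rw [limSet_diff]
      exact Set.sdiff_subset_sdiff_right (haccsub k)
    · have h2 := limMass_union_add_inter (ω := ω)
        (fun n => B n \ Set.accumulate (fun j => A j n) k) (haccmeas k)
      have h3 : limMass ω (fun n => (B n \ Set.accumulate (fun j => A j n) k) ∩
          Set.accumulate (fun j => A j n) k) = 0 := by
        simp only [Set.sdiff_inter_self, limMass_empty]
      have h4 : limMass ω (fun n => (B n \ Set.accumulate (fun j => A j n) k) ∪
          Set.accumulate (fun j => A j n) k) ≤ limMass ω B := by
        refine limMass_mono ?_
        rw [limSet_union, limSet_diff]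
        exact Set.union_subset Set.sdiff_subset (haccB k)
      rw [h3, add_zero] at h2
      rw [h2, hBeq] at h4
      have h5 := h4.trans_lt hk
      rw [add_comm] at h5
      exact lt_of_add_lt_add_left h5
  refine ⟨B, ⟨hB, ((IsNull.iUnion fun k => (h k).2).union hdiff).mono ?_⟩, hBeq⟩
  intro p hp
  simp only [Set.mem_union, Set.mem_symmDiff, Set.mem_sdiff, Set.mem_iUnion] at hp ⊢
  rcases hp with ⟨h1, h2⟩ | ⟨⟨j, h1⟩, h2⟩
  · by_cases hex : ∃ j, p ∈ MMSpace.limSet ω (A j)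
    · obtain ⟨j, hj⟩ := hex
      exact Or.inl ⟨j, Or.inl ⟨hj, fun hM => h2 ⟨j, hM⟩⟩⟩
    · exact Or.inr ⟨h1, hex⟩
  · exact Or.inl ⟨j, Or.inr ⟨h1, fun hA => h2 (hcov j hA)⟩⟩

/-- The σ-algebra of measurable sets of the set-theoretical ultralimit: the sets that differ from
an ultralimit of measurable sets by a nullset. -/
instance : MeasurableSpace (SetUltralimit ω X) where
  MeasurableSet' M := ∃ A : ∀ n, Set (X n), Approx M A
  measurableSet_empty := ⟨fun _ => ∅, by
    simpa only [limSet_empty] using Approx.limSet (ω := ω) (X := X) (fun _ => MeasurableSet.empty)⟩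
  measurableSet_compl _ := fun ⟨A, hA⟩ => ⟨fun n => (A n)ᶜ, hA.compl⟩
  measurableSet_iUnion M hM := by
    choose A hA using hM
    obtain ⟨B, hB, -⟩ := Approx.iUnion hA
    exact ⟨B, hB⟩

theorem measurableSet_iff {M : Set (SetUltralimit ω X)} :
    MeasurableSet M ↔ ∃ A : ∀ n, Set (X n), Approx M A := Iff.rfl

theorem limMass_accumulate {M : ℕ → Set (SetUltralimit ω X)} {A : ℕ → ∀ n, Set (X n)}
    (h : ∀ k, Approx (M k) (A k)) (hd : Pairwise (Function.onFun Disjoint M)) (k : ℕ) :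
    limMass ω (fun n => Set.accumulate (fun j => A j n) k) =
      ∑ j ∈ Finset.range (k + 1), limMass ω (A j) := by
  induction k with
  | zero => simp
  | succ k ih =>
    rw [Finset.sum_range_succ, ← ih, ← limMass_union_add_inter _ (h (k + 1)).1]
    have h0 : limMass ω (fun n => Set.accumulate (fun j => A j n) k ∩ A (k + 1) n) = 0 := by
      refine limMass_eq_zero ((IsNull.iUnion fun j => (h j).2).mono ?_)
      rintro p hp
      rw [limSet_inter] at hp
      obtain ⟨h1, h2⟩ := hp
      obtain ⟨x, rfl⟩ := cls_surjective p
      rw [cls_mem_limSet] at h1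
      have h3 : ∃ j ≤ k, cls ω x ∈ MMSpace.limSet ω (A j) := by
        by_contra hcon
        push Not at hcon
        have : ∀ᶠ n in (ω : Filter ℕ), ∀ j ∈ Set.Iic k, x n ∉ A j n :=
          (eventually_all_finite (Set.finite_Iic k)).2 fun j hj =>
            Ultrafilter.eventually_not.2 fun hh => hcon j hj (cls_mem_limSet.2 hh)
        obtain ⟨n, hn1, hn2⟩ := (h1.and this).exists
        obtain ⟨j, hj, hxj⟩ := Set.mem_accumulate.1 hn1
        exact hn2 j hj hxj
      obtain ⟨j, hj, hxj⟩ := h3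
      have hdis := Set.disjoint_left.1 (hd (show j ≠ k + 1 by omega))
      simp only [Set.mem_iUnion, Set.mem_symmDiff]
      by_cases hM : cls ω x ∈ M j
      · exact ⟨k + 1, Or.inl ⟨h2, hdis hM⟩⟩
      · exact ⟨j, Or.inl ⟨hxj, hM⟩⟩
    rw [h0, add_zero]
    simp only [Set.accumulate_succ]

/-- The ultralimit measure: a measurable set has the mass of an ultralimit set from which it
differs by a nullset. -/
noncomputable def ultraMeasure (ω : Ultrafilter ℕ) (X : ℕ → MMSpace.{u}) :
    Measure (SetUltralimit ω X) :=
  Measure.ofMeasurable (fun _ hM => limMass ω (Classical.choose (measurableSet_iff.1 hM)))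
    (by
      rw [← limMass_empty (ω := ω) (X := X)]
      refine (Classical.choose_spec (measurableSet_iff.1 MeasurableSet.empty)).limMass_eq ?_
      simpa only [limSet_empty] using
        Approx.limSet (ω := ω) (X := X) (fun _ => MeasurableSet.empty))
    (by
      intro M hM hd
      have hA := fun k => Classical.choose_spec (measurableSet_iff.1 (hM k))
      obtain ⟨B, hB, hBm⟩ := Approx.iUnion hA
      rw [(Classical.choose_spec (measurableSet_iff.1 (MeasurableSet.iUnion hM))).limMass_eq hB,
        hBm, ENNReal.tsum_eq_iSup_nat' (tendsto_add_atTop_nat 1)]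
      exact iSup_congr fun k => limMass_accumulate hA hd k)

theorem ultraMeasure_eq {M : Set (SetUltralimit ω X)} {A : ∀ n, Set (X n)} (h : Approx M A) :
    ultraMeasure ω X M = limMass ω A := by
  have hM : MeasurableSet M := ⟨A, h⟩
  rw [ultraMeasure, Measure.ofMeasurable_apply M hM]
  exact (Classical.choose_spec (measurableSet_iff.1 hM)).limMass_eq h

/-! ### The metric ultralimit -/

/-- The metric ultralimit: sequences are identified when `lim_ω d(x n, y n) = 0`. -/
def MetricUltralimit (ω : Ultrafilter ℕ) (X : ℕ → MMSpace.{u}) : Type u :=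
  SeparationQuotient (SetUltralimit ω X)

noncomputable instance : MetricSpace (MetricUltralimit ω X) :=
  inferInstanceAs (MetricSpace (SeparationQuotient (SetUltralimit ω X)))

/-- The natural projection of the set-theoretical onto the metric ultralimit. -/
noncomputable def proj (ω : Ultrafilter ℕ) (X : ℕ → MMSpace.{u}) : SetUltralimit ω X → MetricUltralimit ω X :=
  SeparationQuotient.mk

theorem proj_surjective : Function.Surjective (proj ω X) := SeparationQuotient.surjective_mk

theorem dist_proj (x y : ∀ n, X n) :
    dist (proj ω X (cls ω x)) (proj ω X (cls ω y)) =
      limUnder (ω : Filter ℕ) fun n => dist (x n) (y n) := rfl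

/-- Admissible sets: those whose preimage in the set-theoretical ultralimit is measurable. -/
noncomputable instance : MeasurableSpace (MetricUltralimit ω X) :=
  MeasurableSpace.map (proj ω X) inferInstance

theorem measurable_proj : Measurable (proj ω X) := fun _ h => h

/-- The measure of the metric ultralimit, on the admissible sets. -/
noncomputable def ultralimitMeasure (ω : Ultrafilter ℕ) (X : ℕ → MMSpace.{u}) :
    Measure (MetricUltralimit ω X) :=
  (ultraMeasure ω X).map (proj ω X)

theorem ultralimitMeasure_apply {S : Set (MetricUltralimit ω X)} (hS : MeasurableSet S) :
    ultralimitMeasure ω X S = ultraMeasure ω X (proj ω X ⁻¹' S) :=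
  Measure.map_apply measurable_proj hS

/-- The support of the metric ultralimit: the points all of whose neighbourhoods have positive
measure. -/
def ultralimitSupport (ω : Ultrafilter ℕ) (X : ℕ → MMSpace.{u}) : Set (MetricUltralimit ω X) :=
  (ultralimitMeasure ω X).support

theorem mem_ultralimitSupport {p : MetricUltralimit ω X} :
    p ∈ ultralimitSupport ω X ↔
      ∀ ε : ℝ, 0 < ε → 0 < ultralimitMeasure ω X (Metric.closedBall p ε) := by
  refine (Measure.mem_support_iff_forall p).trans ⟨fun h ε hε => h _ (Metric.closedBall_mem_nhds p hε),
    fun h U hU => ?_⟩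
  obtain ⟨ε, hε, hsub⟩ := Metric.nhds_basis_closedBall.mem_iff.1 hU
  exact (h ε hε).trans_le (measure_mono hsub)

/-- The support of the metric ultralimit is isometric to the mm-space `Y` as a metric measure
space: there is an isometry of `Y` onto the support that carries the measure of `Y` to the
ultralimit measure on the support. -/
def SupportIsometricTo (ω : Ultrafilter ℕ) (X : ℕ → MMSpace.{u}) (Y : MMSpace.{v}) : Prop :=
  ∃ Φ : Y ≃ᵢ ultralimitSupport ω X, ∀ B : Set Y, MeasurableSet B →
    MeasurableSet ((fun y => (Φ y : MetricUltralimit ω X)) '' B) ∧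
      ultralimitMeasure ω X ((fun y => (Φ y : MetricUltralimit ω X)) '' B) = Y.μ B

end MMSpace

/-!
If the box distances tend to zero along `ω`, choose near-optimal parametrizations `Ψ n : I → X n`
and `Φ n : I → Y` with exceptional sets `S n`. Since the measure of `Y` has full support, every
`y : Y` is the limit of some `Φ n (s n)` with `s n ∉ S n`, and sending `y` to the class of the
`Ψ n (s n)` is an isometric embedding of `Y` into the ultralimit. Pulling finite covers of a compact
set back through the parametrizations shows that its image has at least its measure; both spaces
having total mass one, the embedding preserves measure, and its range is the support.

Conversely, cut `Y`, up to small mass, into finitely many disjoint Borel pieces `B i` of small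
diameter and approximate their images from inside by ultraproducts of measurable sets `A i n ⊆ X n`.
By saturation, for `ω`-almost every `n` the `A i n` are disjoint and the distances between points of
`A i n` and `A j n` are close to those between points of `B i` and `B j`. A coupling of the two
measures that matches `A i n` with `B i` on as much mass as possible then bounds the box distance.
-/

section Coupling

variable {α β ι : Type*} [MeasurableSpace α] [MeasurableSpace β]

theorem exists_measure_fst_snd_eq {μ : Measure α} {ν : Measure β} [IsFiniteMeasure ν]
    (h : μ Set.univ = ν Set.univ) : ∃ γ : Measure (α × β), γ.fst = μ ∧ γ.snd = ν := by
  rcases eq_or_ne (ν Set.univ) 0 with h0 | h0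
  · exact ⟨0, by simp [Measure.measure_univ_eq_zero.1 (h.trans h0)],
      by simp [Measure.measure_univ_eq_zero.1 h0]⟩
  · have hinv : (ν Set.univ)⁻¹ * ν Set.univ = 1 := ENNReal.inv_mul_cancel h0 (measure_ne_top ν _)
    refine ⟨(ν Set.univ)⁻¹ • μ.prod ν, ?_, ?_⟩
    · rw [Measure.fst, Measure.map_smul, Measure.map_fst_prod, smul_smul, hinv, one_smul]
    · rw [Measure.snd, Measure.map_smul, Measure.map_snd_prod, smul_smul, h, hinv, one_smul]

theorem sum_restrict_le_of_pairwiseDisjoint (μ : Measure α) {s : Finset ι} {A : ι → Set α}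
    (hA : ∀ i, MeasurableSet (A i)) (hd : (s : Set ι).PairwiseDisjoint A) :
    ∑ i ∈ s, μ.restrict (A i) ≤ μ := by
  rw [← Finset.sum_coe_sort, ← Measure.sum_fintype, ← Measure.restrict_biUnion_finset hd hA]
  exact Measure.restrict_le_self

variable {μ : Measure α} {ν : Measure β} [IsFiniteMeasure μ] [IsFiniteMeasure ν]

theorem exists_ge_fst_snd_eq (h : μ Set.univ = ν Set.univ) {γ₀ : Measure (α × β)}
    (hfst : γ₀.fst ≤ μ) (hsnd : γ₀.snd ≤ ν) : ∃ γ, γ₀ ≤ γ ∧ γ.fst = μ ∧ γ.snd = ν := by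
  have : IsFiniteMeasure γ₀.fst := isFiniteMeasure_of_le μ hfst
  have : IsFiniteMeasure γ₀.snd := isFiniteMeasure_of_le ν hsnd
  have : IsFiniteMeasure (ν - γ₀.snd) := isFiniteMeasure_of_le ν Measure.sub_le
  have hmass : (μ - γ₀.fst) Set.univ = (ν - γ₀.snd) Set.univ := by
    rw [Measure.sub_apply .univ hfst, Measure.sub_apply .univ hsnd, h, Measure.fst_univ,
      Measure.snd_univ]
  obtain ⟨γ, hγ₁, hγ₂⟩ := exists_measure_fst_snd_eq hmass
  refine ⟨γ + γ₀, Measure.le_add_left le_rfl, ?_, ?_⟩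
  · rw [Measure.fst_add, hγ₁, Measure.sub_add_cancel_of_le hfst]
  · rw [Measure.snd_add, hγ₂, Measure.sub_add_cancel_of_le hsnd]

variable (μ ν)

theorem exists_fst_le_restrict_snd_le_restrict (A : Set α) (B : Set β) :
    ∃ γ : Measure (α × β), γ.fst ≤ μ.restrict A ∧ γ.snd ≤ ν.restrict B ∧
      min (μ A) (ν B) ≤ γ (A ×ˢ B) := by
  set M := max (μ A) (ν B) with hMdef
  have hM : M ≠ ∞ := max_ne_top (measure_ne_top μ A) (measure_ne_top ν B)
  have hscale {b : ℝ≥0∞} (hb : b ≤ M) : M⁻¹ * b ≤ 1 :=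
    (mul_le_mul_right hb _).trans (ENNReal.inv_mul_le_one M)
  refine ⟨M⁻¹ • (μ.restrict A).prod (ν.restrict B), ?_, ?_, ?_⟩
  · rw [Measure.fst, Measure.map_smul, Measure.map_fst_prod, smul_smul,
      Measure.restrict_apply_univ]
    exact fun S => mul_le_of_le_one_left' (hscale (le_max_right _ _))
  · rw [Measure.snd, Measure.map_smul, Measure.map_snd_prod, smul_smul,
      Measure.restrict_apply_univ]
    exact fun S => mul_le_of_le_one_left' (hscale (le_max_left _ _))
  · rw [Measure.smul_apply, Measure.prod_prod, Measure.restrict_apply_self,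
      Measure.restrict_apply_self, smul_eq_mul, ← max_mul_min (μ A) (ν B), ← mul_assoc, ← hMdef]
    rcases eq_or_ne M 0 with h0 | h0
    · exact min_le_max.trans (h0.trans_le zero_le)
    · rw [ENNReal.inv_mul_cancel h0 hM, one_mul]

theorem exists_coupling_of_pairwiseDisjoint (h : μ Set.univ = ν Set.univ) {s : Finset ι}
    {A : ι → Set α} {B : ι → Set β} (hA : ∀ i, MeasurableSet (A i)) (hB : ∀ i, MeasurableSet (B i))
    (hdA : (s : Set ι).PairwiseDisjoint A) (hdB : (s : Set ι).PairwiseDisjoint B) :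
    ∃ γ : Measure (α × β), γ.fst = μ ∧ γ.snd = ν ∧
      ∑ i ∈ s, min (μ (A i)) (ν (B i)) ≤ γ (⋃ i ∈ s, A i ×ˢ B i) := by
  choose γ hfst hsnd hmin using fun i => exists_fst_le_restrict_snd_le_restrict μ ν (A i) (B i)
  have hsum_fst : (∑ i ∈ s, γ i).fst ≤ μ := by
    rw [Measure.fst, Measure.map_finset_sum measurable_fst.aemeasurable]
    exact (Finset.sum_le_sum fun i _ => hfst i).trans (sum_restrict_le_of_pairwiseDisjoint μ hA hdA)
  have hsum_snd : (∑ i ∈ s, γ i).snd ≤ ν := by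
    rw [Measure.snd, Measure.map_finset_sum measurable_snd.aemeasurable]
    exact (Finset.sum_le_sum fun i _ => hsnd i).trans (sum_restrict_le_of_pairwiseDisjoint ν hB hdB)
  obtain ⟨γ', hle, h₁, h₂⟩ := exists_ge_fst_snd_eq h hsum_fst hsum_snd
  refine ⟨γ', h₁, h₂, ?_⟩
  calc ∑ i ∈ s, min (μ (A i)) (ν (B i))
      ≤ ∑ i ∈ s, γ i (⋃ i ∈ s, A i ×ˢ B i) := Finset.sum_le_sum fun i hi =>
        (hmin i).trans (measure_mono (Set.subset_iUnion₂ (s := fun i _ => A i ×ˢ B i) i hi))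
    _ = (∑ i ∈ s, γ i) (⋃ i ∈ s, A i ×ˢ B i) := (Measure.finsetSum_apply _ _ _).symm
    _ ≤ γ' (⋃ i ∈ s, A i ×ˢ B i) := hle _

end Coupling

section SeparableSets

-- The σ-algebra of the ultralimit need not contain the open sets, so on `β` only the measurability
-- of the functions `edist · q` is available.
variable {α β : Type*} [MeasurableSpace β]

theorem measurable_infEDist_of_isSeparable [PseudoMetricSpace β]
    (hedist : ∀ q : β, Measurable fun p => edist p q) {S : Set β}
    (hS : TopologicalSpace.IsSeparable S) : Measurable fun p => Metric.infEDist p S := by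
  obtain ⟨c, hcS, hc, hSc⟩ := hS.exists_countable_dense_subset
  have hinf (p : β) : Metric.infEDist p S = ⨅ q ∈ c, edist p q :=
    le_antisymm (Metric.infEDist_anti hcS) <|
      Metric.infEDist_closure.symm.trans_le (Metric.infEDist_anti hSc)
  simp only [hinf]
  exact .biInf c hc fun q _ => hedist q

theorem measurableSet_cthickening_of_isSeparable [PseudoMetricSpace β]
    (hedist : ∀ q : β, Measurable fun p => edist p q) {S : Set β}
    (hS : TopologicalSpace.IsSeparable S) (r : ℝ) : MeasurableSet (Metric.cthickening r S) :=
  measurableSet_le (measurable_infEDist_of_isSeparable hedist hS) measurable_const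

theorem measurableSet_closure_of_isSeparable [PseudoMetricSpace β]
    (hedist : ∀ q : β, Measurable fun p => edist p q) {S : Set β}
    (hS : TopologicalSpace.IsSeparable S) : MeasurableSet (closure S) := by
  rw [← Metric.cthickening_zero]
  exact measurableSet_cthickening_of_isSeparable hedist hS 0

theorem measurableSet_image_of_isometry [MetricSpace α] [CompleteSpace α]
    [SecondCountableTopology α] [MeasurableSpace α] [BorelSpace α] [MetricSpace β]
    (hedist : ∀ q : β, Measurable fun p => edist p q) {F : α → β} (hF : Isometry F)
    {B : Set α} (hB : MeasurableSet B) : MeasurableSet (F '' B) := by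
  have hclosed {C : Set α} (hC : IsClosed C) : MeasurableSet (F '' C) := by
    rw [← (hF.isClosedEmbedding.isClosedMap C hC).closure_eq]
    exact measurableSet_closure_of_isSeparable hedist
      ((TopologicalSpace.IsSeparable.of_separableSpace C).image hF.continuous)
  have hle : (inferInstance : MeasurableSpace α) ≤ MeasurableSpace.comap F inferInstance := by
    rw [BorelSpace.measurable_eq (α := α), borel_eq_generateFrom_isClosed]
    exact MeasurableSpace.generateFrom_le fun C hC =>
      ⟨F '' C, hclosed hC, Set.preimage_image_eq C hF.injective⟩
  obtain ⟨T, hT, rfl⟩ := hle B hB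
  rw [Set.image_preimage_eq_inter_range, ← Set.image_univ]
  exact hT.inter (hclosed isClosed_univ)

theorem tendsto_measure_cthickening_of_isSeparable [PseudoMetricSpace β]
    (hedist : ∀ q : β, Measurable fun p => edist p q) (μ : Measure β) [IsFiniteMeasure μ]
    {S : Set β} (hS : TopologicalSpace.IsSeparable S) :
    Tendsto (fun r => μ (Metric.cthickening r S)) (𝓝[>] 0) (𝓝 (μ (closure S))) := by
  rw [Metric.closure_eq_iInter_cthickening]
  exact tendsto_measure_biInter_gt
    (fun r _ => (measurableSet_cthickening_of_isSeparable hedist hS r).nullMeasurableSet)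
    (fun _ _ _ h => Metric.cthickening_mono h S) ⟨1, one_pos, measure_ne_top μ _⟩

theorem measure_image_eq_of_forall_isCompact_le [MetricSpace α] [CompleteSpace α]
    [SecondCountableTopology α] [MeasurableSpace α] [BorelSpace α] [MetricSpace β]
    (hedist : ∀ q : β, Measurable fun p => edist p q) {F : α → β} (hF : Isometry F)
    {μ : Measure α} [IsFiniteMeasure μ] {ν : Measure β} (huniv : ν Set.univ ≤ μ Set.univ)
    (h : ∀ K, IsCompact K → μ K ≤ ν (F '' K)) {B : Set α} (hB : MeasurableSet B) :
    ν (F '' B) = μ B := by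
  have hcomap {C : Set α} (hC : MeasurableSet C) : ν.comap F C = ν (F '' C) :=
    Measure.comap_apply F hF.injective (fun _ => measurableSet_image_of_isometry hedist hF) ν hC
  have hle : μ ≤ ν.comap F := by
    refine Measure.le_iff.2 fun C hC => ?_
    rw [hC.measure_eq_iSup_isCompact, hcomap hC]
    exact iSup₂_le fun K hKC => iSup_le fun hK =>
      (h K hK).trans (measure_mono (Set.image_mono hKC))
  have hcomap_univ : ν.comap F Set.univ ≤ μ Set.univ := by
    rw [hcomap .univ]
    exact (measure_mono (Set.subset_univ _)).trans huniv
  have : IsFiniteMeasure (ν.comap F) := ⟨hcomap_univ.trans_lt (measure_lt_top μ _)⟩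
  rw [← hcomap hB, Measure.eq_of_le_of_measure_univ_eq hle (le_antisymm (hle _) hcomap_univ)]

end SeparableSets

section Parametrization

variable {Ω ι Y : Type*} [MeasurableSpace Ω] {P : Measure Ω} [PseudoEMetricSpace Y]
  [MeasurableSpace Y] [OpensMeasurableSpace Y] {μ : Measure Y} [μ.IsOpenPosMeasure]
  {l : Filter ι} {Φ : ι → Ω → Y} {S : ι → Set Ω}

theorem tendsto_infEDist_image_compl (hΦ : ∀ n, MeasurePreserving (Φ n) P μ)
    (hS : Tendsto (fun n => P (S n)) l (𝓝 0)) (y : Y) :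
    Tendsto (fun n => Metric.infEDist y (Φ n '' (S n)ᶜ)) l (𝓝 0) := by
  refine tendsto_order.2 ⟨fun r hr => absurd hr not_lt_zero, fun r hr => ?_⟩
  have hpos : 0 < μ (Metric.eball y r) :=
    Metric.isOpen_eball.measure_pos μ ⟨y, Metric.mem_eball_self hr⟩
  filter_upwards [hS.eventually_lt_const hpos] with n hn
  rw [← (hΦ n).measure_preimage Metric.isOpen_eball.measurableSet.nullMeasurableSet] at hn
  obtain ⟨t, hty, htS⟩ := Set.not_subset.1 fun hsub => (measure_mono hsub).not_gt hn
  exact Metric.infEDist_lt_iff.2 ⟨Φ n t, Set.mem_image_of_mem _ htS, by rwa [edist_comm]⟩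

theorem exists_tendsto_of_measurePreserving [l.NeBot] (hΦ : ∀ n, MeasurePreserving (Φ n) P μ)
    {e : ι → ℝ≥0∞} (he : Tendsto e l (𝓝 0)) (he0 : ∀ n, e n ≠ 0) (hS : ∀ n, P (S n) ≤ e n) (y : Y) :
    ∃ s : ι → Ω, (∀ᶠ n in l, s n ∉ S n) ∧ Tendsto (fun n => Φ n (s n)) l (𝓝 y) := by
  have hinf := tendsto_infEDist_image_compl hΦ
    (tendsto_of_tendsto_of_tendsto_of_le_of_le tendsto_const_nhds he (fun _ => zero_le) hS) y
  have hnear : ∀ᶠ n in l, ∃ t, t ∉ S n ∧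
      edist (Φ n t) y < Metric.infEDist y (Φ n '' (S n)ᶜ) + e n := by
    filter_upwards [hinf.eventually_lt_const ENNReal.zero_lt_top] with n hn
    obtain ⟨_, ⟨t, htS, rfl⟩, ht⟩ := Metric.infEDist_lt_iff.1 (ENNReal.lt_add_right hn.ne (he0 n))
    exact ⟨t, htS, by rwa [edist_comm]⟩
  obtain ⟨s, hs⟩ := hnear.choice
  refine ⟨s, hs.mono fun n hn => hn.1, tendsto_iff_edist_tendsto_0.2 ?_⟩
  refine tendsto_of_tendsto_of_tendsto_of_le_of_le' tendsto_const_nhds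
    (by simpa only [add_zero] using hinf.add he) (.of_forall fun _ => zero_le)
    (hs.mono fun n hn => hn.2.le)

end Parametrization

namespace MMSpace

instance (X : MMSpace.{u}) : SecondCountableTopology X :=
  UniformSpace.secondCountable_of_separable X

section Box

variable {X : MMSpace.{u}} {Y : MMSpace.{v}} {ε : ℝ≥0}

/-- Parametrizations `Ψ` of `X` and `Φ` of `Y` whose pulled back distances are `ε`-close off the
exceptional set `S`: the data behind an upper bound `boxDist X Y ≤ ε`. -/
structure IsBoxWitness (ε : ℝ≥0) (Ψ : I → X) (Φ : I → Y) (S : Set I) : Prop where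
  measurePreserving_left : MeasurePreserving Ψ volume X.μ
  measurePreserving_right : MeasurePreserving Φ volume Y.μ
  measurableSet : MeasurableSet S
  volume_le : volume S ≤ ε
  abs_dist_sub_dist_le : ∀ s ∉ S, ∀ t ∉ S, |dist (Ψ s) (Ψ t) - dist (Φ s) (Φ t)| ≤ ε

theorem exists_isBoxWitness_of_boxDist_lt (h : boxDist X Y < ε) :
    ∃ (Ψ : I → X) (Φ : I → Y) (S : Set I), IsBoxWitness ε Ψ Φ S := by
  simp only [boxDist, boxFun, iInf_lt_iff] at h
  obtain ⟨Ψ, hΨ, Φ, hΦ, δ, ⟨S, hS, hSδ, hd⟩, hδε⟩ := h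
  have hle : δ ≤ ε := (ENNReal.coe_lt_coe.1 hδε).le
  exact ⟨Ψ, Φ, S, hΨ, hΦ, hS, hSδ.trans hδε.le, fun s hs t ht =>
    (hd s hs t ht).trans (NNReal.coe_le_coe.2 hle)⟩

namespace IsBoxWitness

variable {Ψ : I → X} {Φ : I → Y} {S : Set I}

theorem boxDist_le (h : IsBoxWitness ε Ψ Φ S) : boxDist X Y ≤ ε :=
  iInf₂_le_of_le Ψ h.measurePreserving_left <| iInf₂_le_of_le Φ h.measurePreserving_right <|
    iInf₂_le ε ⟨S, h.measurableSet, h.volume_le, h.abs_dist_sub_dist_le⟩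

theorem measure_thickening_image_le (h : IsBoxWitness ε Ψ Φ S) {T : Set I} (hT : Disjoint T S)
    (r : ℝ) : Y.μ (Metric.thickening r (Φ '' T)) ≤
      X.μ (Metric.thickening (r + ε) (Ψ '' T)) + ε := by
  have hsub : Φ ⁻¹' Metric.thickening r (Φ '' T) ⊆
      Ψ ⁻¹' Metric.thickening (r + ε) (Ψ '' T) ∪ S := by
    refine fun s hs => or_iff_not_imp_right.2 fun hsS => ?_
    obtain ⟨_, ⟨t, ht, rfl⟩, hst⟩ := Metric.mem_thickening_iff.1 hs
    have hclose := abs_le.1 (h.abs_dist_sub_dist_le s hsS t (hT.notMem_of_mem_left ht))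
    exact Metric.mem_thickening_iff.2 ⟨Ψ t, Set.mem_image_of_mem Ψ ht, by linarith⟩
  rw [← h.measurePreserving_right.measure_preimage Metric.isOpen_thickening.nullMeasurableSet,
    ← h.measurePreserving_left.measure_preimage Metric.isOpen_thickening.nullMeasurableSet]
  exact (measure_mono hsub).trans ((measure_union_le _ _).trans (by gcongr; exact h.volume_le))

theorem measure_le_of_subset_iUnion_ball (h : IsBoxWitness ε Ψ Φ S) {K t : Set Y} {τ : Y → I}
    {r : ℝ} (hε : ε ≤ r) (hK : K ⊆ ⋃ y ∈ t, Metric.ball y r) (hτS : ∀ y ∈ t, τ y ∉ S)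
    (hτ : ∀ y ∈ t, dist (Φ (τ y)) y < r) :
    Y.μ K ≤ X.μ (Metric.thickening (3 * r) (Ψ '' (τ '' t))) + ε := by
  have hKΦ : K ⊆ Metric.thickening (r + r) (Φ '' (τ '' t)) := by
    intro z hz
    obtain ⟨y, hy, hzy⟩ := Set.mem_iUnion₂.1 (hK hz)
    exact Metric.mem_thickening_iff.2
      ⟨Φ (τ y), Set.mem_image_of_mem _ (Set.mem_image_of_mem _ hy),
        (dist_triangle_right _ _ y).trans_lt (add_lt_add hzy (hτ y hy))⟩
  have hdisj : Disjoint (τ '' t) S := Set.disjoint_left.2 (Set.forall_mem_image.2 hτS)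
  calc Y.μ K ≤ Y.μ (Metric.thickening (r + r) (Φ '' (τ '' t))) := measure_mono hKΦ
    _ ≤ X.μ (Metric.thickening (r + r + ε) (Ψ '' (τ '' t))) + ε :=
      h.measure_thickening_image_le hdisj _
    _ ≤ X.μ (Metric.thickening (3 * r) (Ψ '' (τ '' t))) + ε := by
      gcongr
      linarith

end IsBoxWitness

theorem boxDist_le_of_coupling {γ : Measure (X × Y)} (hfst : γ.fst = X.μ) (hsnd : γ.snd = Y.μ)
    {G : Set (X × Y)} (hG : MeasurableSet G) (hGε : γ Gᶜ ≤ ε)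
    (hd : ∀ p ∈ G, ∀ q ∈ G, |dist p.1 q.1 - dist p.2 q.2| ≤ ε) : boxDist X Y ≤ ε := by
  have : IsProbabilityMeasure γ :=
    ⟨by rw [← Measure.fst_univ, hfst, measure_univ]⟩
  obtain ⟨f, hf, hfγ⟩ := Measure.exists_measurable_map_eq γ
  have hf' : MeasurePreserving f volume γ := ⟨hf, hfγ⟩
  have hwitness : IsBoxWitness ε (Prod.fst ∘ f) (Prod.snd ∘ f) (f ⁻¹' Gᶜ) :=
    { measurePreserving_left := .comp ⟨measurable_fst, hfst⟩ hf'
      measurePreserving_right := .comp ⟨measurable_snd, hsnd⟩ hf'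
      measurableSet := hf hG.compl
      volume_le := by rwa [hf'.measure_preimage hG.compl.nullMeasurableSet]
      abs_dist_sub_dist_le := fun s hs t ht => hd _ (not_not.1 hs) _ (not_not.1 ht) }
  exact hwitness.boxDist_le

theorem boxDist_le_one (X : MMSpace.{u}) (Y : MMSpace.{v}) : boxDist X Y ≤ 1 :=
  boxDist_le_of_coupling (ε := 1) (γ := X.μ.prod Y.μ) Measure.fst_prod Measure.snd_prod .empty
    prob_le_one fun _ h => h.elim

theorem boxDist_le_of_pairwiseDisjoint {ι : Type*} {s : Finset ι} {A : ι → Set X} {B : ι → Set Y}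
    (hA : ∀ i, MeasurableSet (A i)) (hB : ∀ i, MeasurableSet (B i))
    (hdA : (s : Set ι).PairwiseDisjoint A) (hdB : (s : Set ι).PairwiseDisjoint B)
    (hmass : 1 ≤ ∑ i ∈ s, min (X.μ (A i)) (Y.μ (B i)) + ε)
    (hdist : ∀ i ∈ s, ∀ j ∈ s, ∀ x ∈ A i, ∀ x' ∈ A j, ∀ y ∈ B i, ∀ y' ∈ B j,
      |dist x x' - dist y y'| ≤ ε) : boxDist X Y ≤ ε := by
  obtain ⟨γ, hfst, hsnd, hγ⟩ :=
    exists_coupling_of_pairwiseDisjoint X.μ Y.μ (by simp only [measure_univ]) hA hB hdA hdB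
  have hG : MeasurableSet (⋃ i ∈ s, A i ×ˢ B i) :=
    s.measurableSet_biUnion fun i _ => (hA i).prod (hB i)
  have : IsProbabilityMeasure γ := ⟨by rw [← Measure.fst_univ, hfst, measure_univ]⟩
  refine boxDist_le_of_coupling hfst hsnd hG ?_ fun p hp q hq => ?_
  · rw [prob_compl_eq_one_sub hG]
    exact tsub_le_iff_left.2 (hmass.trans (by gcongr))
  · simp only [Set.mem_iUnion₂, Set.mem_prod] at hp hq
    obtain ⟨i, hi, hpA, hpB⟩ := hp
    obtain ⟨j, hj, hqA, hqB⟩ := hq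
    exact hdist i hi j hj _ hpA _ hqA _ hpB _ hqB

end Box

variable {ω : Ultrafilter ℕ} {X : ℕ → MMSpace.{u}} {Y : MMSpace.{v}}

section UltralimitMeasure

theorem measurableSet_limSet {A : ∀ n, Set (X n)} (hA : ∀ n, MeasurableSet (A n)) :
    MeasurableSet (limSet ω A) := ⟨A, Approx.limSet hA⟩

theorem ultraMeasure_limSet {A : ∀ n, Set (X n)} (hA : ∀ n, MeasurableSet (A n)) :
    ultraMeasure ω X (limSet ω A) = limMass ω A := ultraMeasure_eq (Approx.limSet hA)

theorem limMass_le_ultralimitMeasure {A : ∀ n, Set (X n)} (hA : ∀ n, MeasurableSet (A n))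
    {M : Set (MetricUltralimit ω X)} (h : limSet ω A ⊆ proj ω X ⁻¹' M) :
    limMass ω A ≤ ultralimitMeasure ω X M := by
  rw [← ultraMeasure_limSet hA]
  exact (measure_mono h).trans (Measure.le_map_apply measurable_proj.aemeasurable M)

instance : IsProbabilityMeasure (ultralimitMeasure ω X) := by
  have huniv : limSet ω (fun n => (∅ : Set (X n))ᶜ) = Set.univ := by
    rw [limSet_compl, limSet_empty, Set.compl_empty]
  refine ⟨?_⟩
  rw [ultralimitMeasure_apply .univ, Set.preimage_univ, ← huniv,
    ultraMeasure_limSet fun _ => MeasurableSet.empty.compl]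
  exact tendsto_nhds_unique (tendsto_limMass _)
    (by simp only [Set.compl_empty, measure_univ, tendsto_const_nhds_iff])

theorem exists_limSet_subset {M : Set (SetUltralimit ω X)} (hM : MeasurableSet M) {δ : ℝ≥0∞}
    (hδ : 0 < δ) : ∃ A : ∀ n, Set (X n), (∀ n, MeasurableSet (A n)) ∧ limSet ω A ⊆ M ∧
      ultraMeasure ω X M ≤ limMass ω A + δ := by
  obtain ⟨A, hA⟩ := hM
  obtain ⟨D, hD, hAD, hDδ⟩ := hA.2 δ hδ
  refine ⟨fun n => A n \ D n, fun n => (hA.1 n).diff (hD n), ?_, ?_⟩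
  · rw [limSet_diff]
    exact fun p hp => by_contra fun hpM => hp.2 (hAD (Or.inl ⟨hp.1, hpM⟩))
  · calc ultraMeasure ω X M = limMass ω A := ultraMeasure_eq hA
      _ ≤ limMass ω (fun n => A n \ D n ∪ D n) := limMass_mono <| by
        rw [limSet_union, limSet_diff, Set.sdiff_union_self]
        exact Set.subset_union_left
      _ ≤ limMass ω (fun n => A n \ D n) + limMass ω D := limMass_union_le _ _
      _ ≤ limMass ω (fun n => A n \ D n) + δ := by gcongr

theorem measurable_dist (q : MetricUltralimit ω X) :
    Measurable fun p : MetricUltralimit ω X => dist p q := by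
  obtain ⟨q, rfl⟩ := proj_surjective q
  obtain ⟨x, rfl⟩ := cls_surjective q
  refine measurable_of_Iic fun r => ?_
  have hball : proj ω X ⁻¹' ((dist · (proj ω X (cls ω x))) ⁻¹' Set.Iic r) =
      ⋂ k : ℕ, limSet ω fun n => Metric.closedBall (x n) (r + 1 / ((k : ℝ) + 1)) := by
    ext p
    obtain ⟨y, rfl⟩ := cls_surjective p
    simp only [Set.mem_iInter, cls_mem_limSet]
    change dist (cls ω y) (cls ω x) ≤ r ↔ _
    refine ⟨fun h k => ?_, fun h => ?_⟩
    · have hk : dist (cls ω y) (cls ω x) < r + 1 / ((k : ℝ) + 1) :=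
        h.trans_lt (lt_add_of_pos_right _ Nat.one_div_pos_of_nat)
      exact ((tendsto_dist_cls y x).eventually_lt_const hk).mono fun n hn => hn.le
    · have hlim : Tendsto (fun k : ℕ => r + 1 / ((k : ℝ) + 1)) atTop (𝓝 r) := by
        simpa only [add_zero] using tendsto_one_div_add_atTop_nhds_zero_nat.const_add r
      exact ge_of_tendsto' hlim fun k => le_of_tendsto (tendsto_dist_cls y x) (h k)
  change MeasurableSet (proj ω X ⁻¹' _)
  rw [hball]
  exact .iInter fun k => measurableSet_limSet fun n => Metric.isClosed_closedBall.measurableSet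

theorem measurable_edist (q : MetricUltralimit ω X) :
    Measurable fun p : MetricUltralimit ω X => edist p q := by
  simp only [edist_dist]
  exact (measurable_dist q).ennreal_ofReal

end UltralimitMeasure

section Support

theorem range_eq_ultralimitSupport {F : Y → MetricUltralimit ω X} (hF : Isometry F)
    (hμ : ∀ B, MeasurableSet B → ultralimitMeasure ω X (F '' B) = Y.μ B) :
    Set.range F = ultralimitSupport ω X := by
  refine Set.Subset.antisymm (Set.range_subset_iff.2 fun y => ?_) ?_
  · refine mem_ultralimitSupport.2 fun ε hε => ?_
    calc 0 < Y.μ (Metric.closedBall y ε) := Metric.measure_closedBall_pos Y.μ y hε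
      _ = ultralimitMeasure ω X (F '' Metric.closedBall y ε) :=
        (hμ _ Metric.isClosed_closedBall.measurableSet).symm
      _ ≤ ultralimitMeasure ω X (Metric.closedBall (F y) ε) :=
        measure_mono (hF.mapsTo_closedBall y ε).image_subset
  · have hrange : MeasurableSet (Set.range F) := by
      rw [← Set.image_univ]
      exact measurableSet_image_of_isometry measurable_edist hF .univ
    refine Measure.support_subset_of_isClosed hF.isClosedEmbedding.isClosed_range ?_
    rw [mem_ae_iff_prob_eq_one hrange, ← Set.image_univ, hμ _ .univ, measure_univ]

theorem supportIsometricTo_iff_exists_isometry : SupportIsometricTo ω X Y ↔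
    ∃ F : Y → MetricUltralimit ω X, Isometry F ∧
      ∀ B, MeasurableSet B → ultralimitMeasure ω X (F '' B) = Y.μ B := by
  refine ⟨fun ⟨Φ, hΦ⟩ => ⟨fun y => Φ y, isometry_subtype_coe.comp Φ.isometry,
    fun B hB => (hΦ B hB).2⟩, fun ⟨F, hF, hμ⟩ => ?_⟩
  have hsupp := range_eq_ultralimitSupport hF hμ
  exact ⟨hF.isometryEquivOnRange.trans ⟨Equiv.setCongr hsupp, fun _ _ => rfl⟩,
    fun B hB => ⟨measurableSet_image_of_isometry measurable_edist hF hB, hμ B hB⟩⟩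

end Support

section BoxLimit

/-- The point of the metric ultralimit represented by the sequence of the `Ψ n (s n)`. -/
noncomputable def limPoint (ω : Ultrafilter ℕ) (Ψ : ∀ n, I → X n) (s : ℕ → I) :
    MetricUltralimit ω X :=
  proj ω X (cls ω fun n => Ψ n (s n))

theorem limSet_thickening_subset {κ : Type*} (Ψ : ∀ n, I → X n) (s : κ → ℕ → I) {t : Set κ}
    (ht : t.Finite) (r : ℝ) :
    limSet ω (fun n => Metric.thickening r (Ψ n '' ((fun y => s y n) '' t))) ⊆
      proj ω X ⁻¹' Metric.cthickening r ((fun y => limPoint ω Ψ (s y)) '' t) := by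
  rintro _ ⟨x, rfl, hx⟩
  simp only [Metric.mem_thickening_iff, Set.exists_mem_image] at hx
  obtain ⟨y, hy, hxy⟩ := (Ultrafilter.eventually_exists_mem_iff ht).1 hx
  exact Metric.mem_cthickening_of_dist_le _ _ r _ (Set.mem_image_of_mem _ hy)
    (le_of_tendsto (tendsto_dist_cls x fun n => Ψ n (s y n)) (hxy.mono fun n hn => hn.le))

variable {e : ℕ → ℝ≥0} {Ψ : ∀ n, I → X n} {Φ : ℕ → I → Y} {S : ℕ → Set I}

theorem dist_limPoint_eq (h : ∀ n, IsBoxWitness (e n) (Ψ n) (Φ n) (S n))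
    (he : Tendsto e ω (𝓝 0)) {s t : ℕ → I} {y z : Y} (hsS : ∀ᶠ n in ω, s n ∉ S n)
    (htS : ∀ᶠ n in ω, t n ∉ S n) (hs : Tendsto (fun n => Φ n (s n)) ω (𝓝 y))
    (ht : Tendsto (fun n => Φ n (t n)) ω (𝓝 z)) :
    dist (limPoint ω Ψ s) (limPoint ω Ψ t) = dist y z := by
  have hdiff : Tendsto
      (fun n => dist (Ψ n (s n)) (Ψ n (t n)) - dist (Φ n (s n)) (Φ n (t n))) ω (𝓝 0) := by
    refine squeeze_zero_norm' ?_ (NNReal.tendsto_coe.2 he)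
    filter_upwards [hsS, htS] with n hsn htn
    exact (h n).abs_dist_sub_dist_le _ hsn _ htn
  have hlim := hdiff.add (hs.dist ht)
  simp only [sub_add_cancel, zero_add] at hlim
  exact tendsto_nhds_unique (tendsto_dist_cls _ _) hlim

theorem measure_le_ultralimitMeasure_cthickening
    (h : ∀ n, IsBoxWitness (e n) (Ψ n) (Φ n) (S n)) (he : Tendsto e ω (𝓝 0)) {s : Y → ℕ → I}
    (hsS : ∀ y, ∀ᶠ n in ω, s y n ∉ S n) (hs : ∀ y, Tendsto (fun n => Φ n (s y n)) ω (𝓝 y))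
    {K : Set Y} (hK : IsCompact K) {r : ℝ} (hr : 0 < r) :
    Y.μ K ≤ ultralimitMeasure ω X
      (Metric.cthickening (3 * r) ((fun y => limPoint ω Ψ (s y)) '' K)) := by
  obtain ⟨t, htK, ht, hKt⟩ := hK.finite_cover_balls hr
  let A : ∀ n, Set (X n) := fun n =>
    Metric.thickening (3 * r) (Ψ n '' ((fun y => s y n) '' t))
  have hbound : ∀ᶠ n in ω, Y.μ K ≤ (X n).μ (A n) + e n := by
    have hnear : ∀ᶠ n in (ω : Filter ℕ), ∀ y ∈ t, s y n ∉ S n ∧ dist (Φ n (s y n)) y < r :=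
      (eventually_all_finite ht).2 fun y _ =>
        (hsS y).and ((hs y).eventually_mem (Metric.ball_mem_nhds y hr))
    filter_upwards [hnear, (NNReal.tendsto_coe.2 he).eventually_lt_const hr] with n hn hen
    exact (h n).measure_le_of_subset_iUnion_ball hen.le hKt (fun y hy => (hn y hy).1)
      fun y hy => (hn y hy).2
  have hlim := (tendsto_limMass A).add (ENNReal.tendsto_coe.2 he)
  rw [ENNReal.coe_zero, add_zero] at hlim
  calc Y.μ K ≤ limMass ω A := ge_of_tendsto hlim hbound
    _ ≤ ultralimitMeasure ω X (Metric.cthickening (3 * r) ((fun y => limPoint ω Ψ (s y)) '' t)) :=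
      limMass_le_ultralimitMeasure (fun n => Metric.isOpen_thickening.measurableSet)
        (limSet_thickening_subset Ψ s ht _)
    _ ≤ _ := measure_mono (Metric.cthickening_subset_of_subset _ (Set.image_mono htK))

theorem supportIsometricTo_of_isBoxWitness (h : ∀ n, IsBoxWitness (e n) (Ψ n) (Φ n) (S n))
    (he : Tendsto e ω (𝓝 0)) (he0 : ∀ n, e n ≠ 0) : SupportIsometricTo ω X Y := by
  choose s hsS hs using exists_tendsto_of_measurePreserving (l := (ω : Filter ℕ))
    (fun n => (h n).measurePreserving_right) (ENNReal.tendsto_coe.2 he)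
    (fun n => ENNReal.coe_ne_zero.2 (he0 n)) (fun n => (h n).volume_le)
  let F : Y → MetricUltralimit ω X := fun y => limPoint ω Ψ (s y)
  have hF : Isometry F := Isometry.of_dist_eq fun y z =>
    dist_limPoint_eq h he (hsS y) (hsS z) (hs y) (hs z)
  have hcompact (K : Set Y) (hK : IsCompact K) : Y.μ K ≤ ultralimitMeasure ω X (F '' K) := by
    have hFK : IsCompact (F '' K) := hK.image hF.continuous
    rw [← hFK.isClosed.closure_eq]
    refine ge_of_tendsto
      (tendsto_measure_cthickening_of_isSeparable measurable_edist _ hFK.isSeparable)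
      (eventually_mem_nhdsWithin.mono fun r hr => ?_)
    rw [← mul_div_cancel₀ r three_ne_zero]
    exact measure_le_ultralimitMeasure_cthickening h he hsS hs hK (div_pos hr three_pos)
  exact supportIsometricTo_iff_exists_isometry.2 ⟨F, hF, fun B hB =>
    measure_image_eq_of_forall_isCompact_le measurable_edist hF
      (by simp only [measure_univ, le_refl]) hcompact hB⟩

theorem supportIsometricTo_of_tendsto_boxDist (hω : (ω : Filter ℕ) ≤ atTop)
    (h : Tendsto (fun n => boxDist (X n) Y) ω (𝓝 0)) : SupportIsometricTo ω X Y := by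
  let e : ℕ → ℝ≥0 := fun n => (boxDist (X n) Y).toNNReal + 1 / ((n : ℝ≥0) + 1)
  have hpos (n : ℕ) : 0 < 1 / ((n : ℝ≥0) + 1) := by positivity
  have hlt (n : ℕ) : boxDist (X n) Y < e n := by
    have hfin : boxDist (X n) Y ≠ ∞ := ne_top_of_le_ne_top ENNReal.one_ne_top (boxDist_le_one _ _)
    rw [← ENNReal.coe_toNNReal hfin]
    exact ENNReal.coe_lt_coe.2 (lt_add_of_pos_right _ (hpos n))
  have he : Tendsto e ω (𝓝 0) := by
    have hadd := ((ENNReal.tendsto_toNNReal ENNReal.zero_ne_top).comp h).add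
      ((tendsto_one_div_add_atTop_nhds_zero_nat (𝕜 := ℝ≥0)).mono_left hω)
    rwa [ENNReal.toNNReal_zero, add_zero] at hadd
  choose Ψ Φ S hwitness using fun n => exists_isBoxWitness_of_boxDist_lt (hlt n)
  exact supportIsometricTo_of_isBoxWitness hwitness he fun n =>
    ((hpos n).trans_le le_add_self).ne'

end BoxLimit

section Saturation

theorem eventually_forall_exists_abs_dist_sub_lt (A B : ∀ n, Set (X n)) {ε : ℝ} (hε : 0 < ε) :
    ∀ᶠ n in (ω : Filter ℕ), ∀ x ∈ A n, ∀ y ∈ B n,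
      ∃ p ∈ limSet ω A, ∃ q ∈ limSet ω B, |dist x y - dist p q| < ε := by
  by_contra hc
  rw [← Ultrafilter.eventually_not] at hc
  push Not at hc
  have hbad : ∀ᶠ n in (ω : Filter ℕ), ∃ z : X n × X n, z.1 ∈ A n ∧ z.2 ∈ B n ∧
      ∀ p ∈ limSet ω A, ∀ q ∈ limSet ω B, ε ≤ |dist z.1 z.2 - dist p q| :=
    hc.mono fun n ⟨x, hx, y, hy, hxy⟩ => ⟨(x, y), hx, hy, hxy⟩
  obtain ⟨z, hz⟩ := Filter.skolem.1 hbad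
  have hp : cls ω (fun n => (z n).1) ∈ limSet ω A := cls_mem_limSet.2 (hz.mono fun n hn => hn.1)
  have hq : cls ω (fun n => (z n).2) ∈ limSet ω B := cls_mem_limSet.2 (hz.mono fun n hn => hn.2.1)
  have hlim := ((tendsto_dist_cls (ω := ω) (fun n => (z n).1) fun n => (z n).2).sub_const
    (dist (cls ω fun n => (z n).1) (cls ω fun n => (z n).2))).abs
  rw [sub_self, abs_zero] at hlim
  exact hε.not_ge (ge_of_tendsto hlim (hz.mono fun n hn => hn.2.2 _ hp _ hq))

theorem eventually_disjoint {A B : ∀ n, Set (X n)} (h : Disjoint (limSet ω A) (limSet ω B)) :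
    ∀ᶠ n in (ω : Filter ℕ), Disjoint (A n) (B n) := by
  have hsub : limSet ω A ⊆ limSet ω fun n => (B n)ᶜ := by
    rw [limSet_compl]
    exact h.subset_compl_right
  exact (eventually_subset hsub).mono fun n hn => Set.disjoint_left.2 fun x hx => hn hx

end Saturation

section BoxConvergence

variable {F : Y → MetricUltralimit ω X} {A : ℕ → ∀ n, Set (X n)} {B : ℕ → Set Y} {δ : ℝ≥0}

theorem eventually_abs_dist_sub_le_of_limSet_subset (hF : Isometry F) {i j : ℕ}
    (hi : limSet ω (A i) ⊆ proj ω X ⁻¹' (F '' B i)) (hj : limSet ω (A j) ⊆ proj ω X ⁻¹' (F '' B j))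
    (hδ : 0 < δ) (hB : ∀ i, ∀ y ∈ B i, ∀ z ∈ B i, dist y z ≤ δ) :
    ∀ᶠ n in (ω : Filter ℕ), ∀ x ∈ A i n, ∀ x' ∈ A j n, ∀ y ∈ B i, ∀ y' ∈ B j,
      |dist x x' - dist y y'| ≤ 3 * δ := by
  filter_upwards [eventually_forall_exists_abs_dist_sub_lt (A i) (A j) (NNReal.coe_pos.2 hδ)]
    with n hn x hx x' hx' y hy y' hy'
  obtain ⟨p, hp, q, hq, hpq⟩ := hn x hx x' hx'
  obtain ⟨z, hz, hzp⟩ := hi hp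
  obtain ⟨z', hz', hzq⟩ := hj hq
  have hdist : dist p q = dist z z' := by
    rw [← hF.dist_eq, hzp, hzq]
    rfl
  rw [hdist] at hpq
  have hzy : |dist z z' - dist y y'| ≤ dist z y + dist z' y' := dist_dist_dist_le z z' y y'
  linarith [abs_sub_le (dist x x') (dist z z') (dist y y'), hB i z hz y hy, hB j z' hz' y' hy']

theorem eventually_boxDist_le_of_limSet_subset (hF : Isometry F) {s : Finset ℕ}
    (hA : ∀ i n, MeasurableSet (A i n)) (hB : ∀ i, MeasurableSet (B i))
    (hdB : (s : Set ℕ).PairwiseDisjoint B) (hAB : ∀ i, limSet ω (A i) ⊆ proj ω X ⁻¹' (F '' B i))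
    (hδ : 0 < δ) (hdiam : ∀ i, ∀ y ∈ B i, ∀ z ∈ B i, dist y z ≤ δ)
    (hmass : 1 < ∑ i ∈ s, min (limMass ω (A i)) (Y.μ (B i)) + (3 * δ : ℝ≥0)) :
    ∀ᶠ n in ω, boxDist (X n) Y ≤ (3 * δ : ℝ≥0) := by
  have hdist : ∀ᶠ n in (ω : Filter ℕ), ∀ i ∈ s, ∀ j ∈ s, ∀ x ∈ A i n, ∀ x' ∈ A j n,
      ∀ y ∈ B i, ∀ y' ∈ B j, |dist x x' - dist y y'| ≤ 3 * δ :=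
    s.eventually_all.2 fun i _ => s.eventually_all.2 fun j _ =>
      eventually_abs_dist_sub_le_of_limSet_subset hF (hAB i) (hAB j) hδ hdiam
  have hdA : ∀ᶠ n in (ω : Filter ℕ), (s : Set ℕ).PairwiseDisjoint fun i => A i n :=
    s.eventually_all.2 fun i hi => s.eventually_all.2 fun j hj => by
      rw [eventually_imp_distrib_left]
      intro hij
      have hdisj : Disjoint (F '' B i) (F '' B j) :=
        (Set.disjoint_image_iff hF.injective).2 (hdB hi hj hij)
      exact eventually_disjoint ((hdisj.preimage _).mono (hAB i) (hAB j))
  have hmass' : ∀ᶠ n in (ω : Filter ℕ),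
      1 < ∑ i ∈ s, min ((X n).μ (A i n)) (Y.μ (B i)) + (3 * δ : ℝ≥0) :=
    ((tendsto_finsetSum s fun i _ => (tendsto_limMass (A i)).min tendsto_const_nhds).add
      tendsto_const_nhds).eventually_const_lt hmass
  filter_upwards [hdist, hdA, hmass'] with n hdist hdA hmass
  exact boxDist_le_of_pairwiseDisjoint (fun i => hA i n) hB hdA hdB hmass.le
    (by simpa only [NNReal.coe_mul, NNReal.coe_ofNat] using hdist)

theorem exists_limSet_subset_image (hF : Isometry F)
    (hμ : ∀ B, MeasurableSet B → ultralimitMeasure ω X (F '' B) = Y.μ B)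
    (hB : ∀ i, MeasurableSet (B i)) {η : ℕ → ℝ≥0∞} (hη : ∀ i, 0 < η i) :
    ∃ A : ℕ → ∀ n, Set (X n), (∀ i n, MeasurableSet (A i n)) ∧
      (∀ i, limSet ω (A i) ⊆ proj ω X ⁻¹' (F '' B i)) ∧
      ∀ i, Y.μ (B i) ≤ min (limMass ω (A i)) (Y.μ (B i)) + η i := by
  have himage (i : ℕ) : MeasurableSet (F '' B i) :=
    measurableSet_image_of_isometry measurable_edist hF (hB i)
  choose A hA hAB hmass using fun i =>
    exists_limSet_subset (measurable_proj (himage i)) (hη i)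
  refine ⟨A, hA, hAB, fun i => ?_⟩
  rw [min_add, ← hμ _ (hB i), ultralimitMeasure_apply (himage i)]
  exact le_min (hmass i) le_self_add

theorem eventually_boxDist_le (h : SupportIsometricTo ω X Y) (hδ : 0 < δ) :
    ∀ᶠ n in ω, boxDist (X n) Y ≤ (3 * δ : ℝ≥0) := by
  obtain ⟨F, hF, hμ⟩ := supportIsometricTo_iff_exists_isometry.1 h
  obtain ⟨B, hB, hbdd, hdiam, hcover, hdisj⟩ :=
    SeparableSpace.exists_measurable_partition_diam_le Y (NNReal.coe_pos.2 hδ)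
  have hδ' : (δ : ℝ≥0∞) ≠ 0 := ENNReal.coe_ne_zero.2 hδ.ne'
  obtain ⟨η, hη, hηδ⟩ := ENNReal.exists_pos_sum_of_countable' hδ' ℕ
  obtain ⟨A, hA, hAB, hmin⟩ := exists_limSet_subset_image hF hμ hB hη
  obtain ⟨J, hJ⟩ : ∃ J, 1 < ∑ i ∈ Finset.range J, Y.μ (B i) + δ := by
    have htotal : ∑' i, Y.μ (B i) = 1 := by
      rw [← measure_iUnion hdisj hB, hcover, measure_univ]
    have hlim := (ENNReal.tendsto_nat_tsum fun i => Y.μ (B i)).add_const (δ : ℝ≥0∞)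
    rw [htotal] at hlim
    exact (hlim.eventually_const_lt (ENNReal.lt_add_right ENNReal.one_ne_top hδ')).exists
  refine eventually_boxDist_le_of_limSet_subset (s := Finset.range J) hF hA hB
    (hdisj.set_pairwise _) hAB hδ
    (fun i y hy z hz => (Metric.dist_le_diam_of_mem (hbdd i) hy hz).trans (hdiam i)) ?_
  calc (1 : ℝ≥0∞) < ∑ i ∈ Finset.range J, Y.μ (B i) + δ := hJ
    _ ≤ ∑ i ∈ Finset.range J, (min (limMass ω (A i)) (Y.μ (B i)) + η i) + δ := by
      gcongr with i
      exact hmin i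
    _ ≤ ∑ i ∈ Finset.range J, min (limMass ω (A i)) (Y.μ (B i)) + δ + δ := by
      rw [Finset.sum_add_distrib]
      gcongr
      exact (ENNReal.sum_le_tsum _).trans hηδ.le
    _ ≤ ∑ i ∈ Finset.range J, min (limMass ω (A i)) (Y.μ (B i)) + (3 * δ : ℝ≥0) := by
      rw [add_assoc, ← ENNReal.coe_add]
      gcongr
      linarith [NNReal.coe_nonneg δ]

theorem tendsto_boxDist_of_supportIsometricTo (h : SupportIsometricTo ω X Y) :
    Tendsto (fun n => boxDist (X n) Y) ω (𝓝 0) := by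
  refine ENNReal.tendsto_nhds_zero.2 fun ε hε => ?_
  obtain ⟨δ, hδ, hδε⟩ := ENNReal.lt_iff_exists_nnreal_btwn.1 hε
  filter_upwards [eventually_boxDist_le h (div_pos (ENNReal.coe_pos.1 hδ) three_pos)] with n hn
  rw [mul_div_cancel₀ _ three_ne_zero] at hn
  exact hn.trans hδε.le

end BoxConvergence

end MMSpace

theorem le_atTop_of_ne_pure {ω : Ultrafilter ℕ} (hω : ∀ n : ℕ, ω ≠ pure n) :
    (ω : Filter ℕ) ≤ atTop := by
  rw [← Nat.cofinite_eq_atTop]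
  exact ω.le_cofinite_or_eq_pure.resolve_right fun ⟨n, hn⟩ => hω n hn

theorem mainTheorem7_general (ω : Ultrafilter ℕ) (hω : ∀ n : ℕ, ω ≠ pure n)
    (X : ℕ → MMSpace.{u}) (Y : MMSpace.{v}) :
    MMSpace.SupportIsometricTo ω X Y ↔ Tendsto (fun n => MMSpace.boxDist (X n) Y) ω (𝓝 0) :=
  ⟨MMSpace.tendsto_boxDist_of_supportIsometricTo,
    MMSpace.supportIsometricTo_of_tendsto_boxDist (le_atTop_of_ne_pure hω)⟩

theorem mainTheorem7 (ω : Ultrafilter ℕ) (hω : ∀ n : ℕ, ω ≠ pure n)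
    (X : ℕ → MMSpace.{u}) (Y : MMSpace.{v}) :
    (Tendsto (fun n => MMSpace.boxDist (X n) Y) atTop (𝓝 0) →
        MMSpace.SupportIsometricTo ω X Y) ∧
      (MMSpace.SupportIsometricTo ω X Y →
        ∀ ε : ℝ≥0∞, 0 < ε → {n : ℕ | MMSpace.boxDist (X n) Y < ε} ∈ ω) :=
  ⟨fun h => (mainTheorem7_general ω hω X Y).2 (h.mono_left (le_atTop_of_ne_pure hω)),
    fun h _ hε => ((mainTheorem7_general ω hω X Y).1 h).eventually_lt_const hε⟩
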